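/- Let $f_c \ge 0$ be an integer, $n = 2f_c+1$, let $\eta>0$ be real and $y \in \mathbb{C}^n$. Let $\mathbb{T}=\mathbb{R}/\mathbb{Z}$ be the unit interval with its endpoints identified. Index the coordinates of $\mathbb{C}^n$ by $l = 1,\dots,n$, the $l$-th one corresponding to the frequency $k_l = l-1-f_c \in \{-f_c,\dots,f_c\}$. For a finite complex measure $x$ on $\mathbb{T}$ let $\|x\|_{\mathrm{TV}}$ be its total-variation norm and let $\mathcal{F}_n x \in \mathbb{C}^n$ be the vector of its lowest $n$ Fourier coefficients, $(\mathcal{F}_n x)_l = \int_{\mathbb{T}} e^{-2\pi i k_l t}\,x(dt)$. For $c\in\mathbb{C}^n$ put $(\mathcal{F}_n^* c)(t) = \sum_{l=1}^{n} c_l e^{2\pi i k_l t}$, and let $\langle y, c\rangle = \operatorname{Re}(y^* c)$. Consider the sines-and-spikes program $$\min_{\tilde x,\ \tilde s\in\mathbb{C}^n}\ \|\tilde x\|_{\mathrm{TV}} + \eta\|\tilde s\|_1 \quad\text{subject to}\quad \mathcal{F}_n \tilde x+\tilde s = y,$$ where $\tilde x$ ranges over all finite complex measures on $\mathbb{T}$,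 and its dual $$\max_{c\in\mathbb{C}^n}\ \langle y,c\rangle \quad\text{subject to}\quad \|\mathcal{F}_n^* c\|_\infty\le 1 \ \text{ and }\ \|c\|_\infty\le\eta .$$ Let $(\hat x,\hat s)$ be a solution of the first program, where $\hat x$ is an atomic measure $$\hat x = \sum_{t_j\in\hat T}\hat a_j\,\delta_{t_j} = \sum_{t_j\in\hat T}|\hat a_j| e^{i\phi_j}\,\delta_{t_j},\qquad \hat a_j \neq 0,$$ with (finite or countable) support $\hat T\subset\mathbb{T}$ and real phases $\phi_j$, the series being absolutely convergent, and where $\hat s_l = |\hat s_l| e^{i\psi_l}$ with real $\psi_l$ for $l\in\hat S = \{l : \hat s_l\neq 0\}$. Let $\hat c\in\mathbb{C}^n$ be any solution of the dual program. Then $$(\mathcal{F}_n^*\hat c)(t_j) = e^{i\phi_j}\quad\text{for every } t_j\in\hat T,\qquad\text{and}\qquad \hat c_l = \eta\, e^{i\psi_l}\quad\text{for every } l\in\hat S .$$ -/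

import Mathlib

open MeasureTheory

namespace SinesSpikes

/-- The total variation of a complex measure is a finite measure. -/
theorem variation_univ_lt_top {X : Type*} [MeasurableSpace X] (x : ComplexMeasure X) :
    x.variation Set.univ < ⊤ := by
  have key : x.variation ≤ (ComplexMeasure.re x).variation + (ComplexMeasure.im x).variation := by
    refine VectorMeasure.variation_le_of_forall_enorm_le fun E _ => ?_
    have h1 : ‖x E‖ₑ ≤ ‖(ComplexMeasure.re x) E‖ₑ + ‖(ComplexMeasure.im x) E‖ₑ := by
      have h2 : x E = (((ComplexMeasure.re x) E : ℝ) : ℂ)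
          + (((ComplexMeasure.im x) E : ℝ) : ℂ) * Complex.I := (Complex.re_add_im (x E)).symm
      rw [h2]
      refine (enorm_add_le _ _).trans (le_of_eq ?_)
      simp [← ofReal_norm]
    rw [Measure.add_apply]
    exact h1.trans (add_le_add (VectorMeasure.enorm_measure_le_variation _ _)
      (VectorMeasure.enorm_measure_le_variation _ _))
  refine (key Set.univ).trans_lt ?_
  rw [Measure.add_apply, ← SignedMeasure.totalVariation_eq_variation,
    ← SignedMeasure.totalVariation_eq_variation]
  exact ENNReal.add_lt_top.2 ⟨measure_lt_top _ _, measure_lt_top _ _⟩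

/-- The total-variation norm of a complex measure on the circle `ℝ / ℤ`, that is, the mass of its
total variation measure (a finite number, by `variation_univ_lt_top`). -/
noncomputable def tvNorm (x : ComplexMeasure UnitAddCircle) : ℝ :=
  (x.variation Set.univ).toReal

/-- The frequency `k ∈ {-fc, …, fc}` that belongs to the index `l` of a vector in `ℂⁿ`,
`n = 2 fc + 1`. -/
def freq (fc : ℕ) (l : Fin (2 * fc + 1)) : ℤ := (l : ℤ) - (fc : ℤ)

/-- The operator `Fₙ` which maps a complex measure to its `n = 2 fc + 1` lowest Fourier
coefficients `∫ exp (-2 π i k t) x(dt)`, `|k| ≤ fc`. -/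
noncomputable def fourierMap (fc : ℕ) (x : ComplexMeasure UnitAddCircle) :
    Fin (2 * fc + 1) → ℂ :=
  fun l => x.integral (fun t => fourier (-freq fc l) t) (ContinuousLinearMap.mul ℝ ℂ)

/-- The trigonometric polynomial `Fₙ* c`, `t ↦ ∑_{|k| ≤ fc} c_k exp (2 π i k t)`. -/
noncomputable def fourierAdjoint (fc : ℕ) (c : Fin (2 * fc + 1) → ℂ) (t : UnitAddCircle) : ℂ :=
  ∑ l, c l * fourier (freq fc l) t

/-- The real inner product `⟨y, c⟩ = Re (y* c)` on `ℂⁿ`. -/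
noncomputable def realInner {n : ℕ} (y c : Fin n → ℂ) : ℝ :=
  (∑ l, (starRingEnd ℂ) (y l) * c l).re

/-- The cost `‖x‖_TV + η ‖s‖₁`. -/
noncomputable def primalCost (fc : ℕ) (η : ℝ)
    (p : ComplexMeasure UnitAddCircle × (Fin (2 * fc + 1) → ℂ)) : ℝ :=
  tvNorm p.1 + η * ∑ l, ‖p.2 l‖

/-- The pairs `(x, s)` with `Fₙ x + s = y`. -/
def primalFeasible (fc : ℕ) (y : Fin (2 * fc + 1) → ℂ) :
    Set (ComplexMeasure UnitAddCircle × (Fin (2 * fc + 1) → ℂ)) :=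
  {p | fourierMap fc p.1 + p.2 = y}

/-- `(x, s)` minimizes `‖x‖_TV + η ‖s‖₁` over all complex measures `x` and all `s ∈ ℂⁿ` subject to
`Fₙ x + s = y`. -/
def IsPrimalSolution (fc : ℕ) (η : ℝ) (y : Fin (2 * fc + 1) → ℂ)
    (x : ComplexMeasure UnitAddCircle) (s : Fin (2 * fc + 1) → ℂ) : Prop :=
  (x, s) ∈ primalFeasible fc y ∧ IsMinOn (primalCost fc η) (primalFeasible fc y) (x, s)

/-- The vectors `c` with `‖Fₙ* c‖_∞ ≤ 1` and `‖c‖_∞ ≤ η`. -/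
def dualFeasible (fc : ℕ) (η : ℝ) : Set (Fin (2 * fc + 1) → ℂ) :=
  {c | (∀ t, ‖fourierAdjoint fc c t‖ ≤ 1) ∧ ∀ l, ‖c l‖ ≤ η}

/-- `c` maximizes `⟨y, c⟩` subject to `‖Fₙ* c‖_∞ ≤ 1` and `‖c‖_∞ ≤ η`. -/
def IsDualSolution (fc : ℕ) (η : ℝ) (y c : Fin (2 * fc + 1) → ℂ) : Prop :=
  c ∈ dualFeasible fc η ∧ IsMaxOn (realInner y) (dualFeasible fc η) c

/-- `x = ∑_{t ∈ T} a_t δ_t`: the measure `x` is the superposition of the point masses `a_t` at the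
points of `T`. The sum converges absolutely on every measurable set. -/
def IsSuperposition (x : ComplexMeasure UnitAddCircle) (T : Set UnitAddCircle) (a : T → ℂ) : Prop :=
  ∀ E : Set UnitAddCircle, MeasurableSet E →
    HasSum (fun t : T => VectorMeasure.dirac (t : UnitAddCircle) (a t) E) (x E)

end SinesSpikes

/-!
The proof is complementary slackness, once strong duality is known.

*Strong duality.* The value `v u` of the primal program with right-hand side `u` (`primalValue`) is
a sublinear function of `u ∈ ℂⁿ`. By the Hahn-Banach theorem some real-linear functional `⟨·, c'⟩`
lies below `v` and agrees with it at `y`. Testing `⟨·, c'⟩ ≤ v` on the vectors `Fₙ (z δ_t)`, where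
`v ≤ |z|`, and on the multiples `z e_l` of the unit vectors, where `v ≤ η |z|`, gives
`‖Fₙ* c'‖_∞ ≤ 1` and `‖c'‖_∞ ≤ η`. So `c'` is dual feasible and the optimal values of the two
programs agree (`exists_dualFeasible_realInner_eq_primalValue`); in particular
`‖x‖_TV + η ‖s‖₁ ≤ ⟨y, c⟩` for the given solutions (`primalCost_le_realInner_of_isSolution`).

*Slackness.* Weak duality is `⟨Fₙ x, c⟩ ≤ ‖x‖_TV` (`realInner_fourierMap_le_tvNorm`) together with
`⟨s, c⟩ ≤ η ‖s‖₁` (`realInner_le`). To read off the value of `Fₙ* c` at an atom `t`, the measure is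
split into `a_t δ_t` and its restriction to the complement of `t`. The total variation is additive
over this splitting (`tvNorm_eq_norm_apply_singleton_add`), so all the inequalities add up to an
equality only if `Re (conj a_t (Fₙ* c) t) = |a_t|`, which with `|(Fₙ* c) t| ≤ 1` forces `(Fₙ* c) t`
to be the phase of `a_t` (`eq_mul_exp_of_mul_norm_le_re`). The coordinates of `s` are treated in the
same way. No countable sum over the support is ever formed.
-/

namespace SinesSpikes

/-! ### Total variation and Fourier coefficients -/

instance (x : ComplexMeasure UnitAddCircle) : IsFiniteMeasure x.variation :=
  ⟨variation_univ_lt_top x⟩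

theorem tvNorm_nonneg (x : ComplexMeasure UnitAddCircle) : 0 ≤ tvNorm x :=
  ENNReal.toReal_nonneg

theorem tvNorm_add_le (x x' : ComplexMeasure UnitAddCircle) :
    tvNorm (x + x') ≤ tvNorm x + tvNorm x' := by
  unfold tvNorm
  rw [← ENNReal.toReal_add (measure_ne_top _ _) (measure_ne_top _ _)]
  exact ENNReal.toReal_mono (by finiteness) (VectorMeasure.variation_add_le Set.univ)

theorem tvNorm_smul (r : ℝ) (x : ComplexMeasure UnitAddCircle) :
    tvNorm (r • x) = ‖r‖ * tvNorm x := by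
  simp [tvNorm, VectorMeasure.variation_smul]

theorem tvNorm_dirac (t : UnitAddCircle) (z : ℂ) : tvNorm (VectorMeasure.dirac t z) = ‖z‖ := by
  simp [tvNorm]

/-- Total variation is additive over the decomposition of `x` into its atom at `t` and the rest. -/
theorem tvNorm_eq_norm_apply_singleton_add (x : ComplexMeasure UnitAddCircle) (t : UnitAddCircle) :
    tvNorm x = ‖x {t}‖ + tvNorm (x.restrict {t}ᶜ) := by
  have ht : MeasurableSet ({t} : Set UnitAddCircle) := measurableSet_singleton t
  rw [← tvNorm_dirac t (x {t}), ← VectorMeasure.restrict_singleton]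
  unfold tvNorm
  rw [VectorMeasure.variation_restrict ht, VectorMeasure.variation_restrict ht.compl,
    ← ENNReal.toReal_add (measure_ne_top _ _) (measure_ne_top _ _),
    ← Measure.add_apply, Measure.restrict_add_restrict_compl ht]

theorem _root_.ContinuousMap.integrable_variation (f : C(UnitAddCircle, ℂ))
    (x : ComplexMeasure UnitAddCircle) : x.Integrable f :=
  f.continuous.integrable_of_hasCompactSupport (HasCompactSupport.of_compactSpace _)

theorem fourierMap_add (fc : ℕ) (x x' : ComplexMeasure UnitAddCircle) :
    fourierMap fc (x + x') = fourierMap fc x + fourierMap fc x' := by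
  ext l
  exact VectorMeasure.integral_add_vectorMeasure
    ((fourier _).integrable_variation x) ((fourier _).integrable_variation x')

theorem fourierMap_smul (fc : ℕ) (r : ℝ) (x : ComplexMeasure UnitAddCircle) :
    fourierMap fc (r • x) = r • fourierMap fc x := by
  ext l
  exact VectorMeasure.integral_smul_vectorMeasure _ r

theorem fourierMap_dirac (fc : ℕ) (t : UnitAddCircle) (z : ℂ) (l : Fin (2 * fc + 1)) :
    fourierMap fc (VectorMeasure.dirac t z) l = fourier (-freq fc l) t * z :=
  VectorMeasure.integral_dirac

/-! ### Weak duality -/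

theorem realInner_add_left {n : ℕ} (u v c : Fin n → ℂ) :
    realInner (u + v) c = realInner u c + realInner v c := by
  simp [realInner, add_mul, Finset.sum_add_distrib]

/-- Pairing a point mass with `c` evaluates the trigonometric polynomial `Fₙ* c`. -/
theorem realInner_fourierMap_dirac (fc : ℕ) (c : Fin (2 * fc + 1) → ℂ) (t : UnitAddCircle)
    (z : ℂ) : realInner (fourierMap fc (VectorMeasure.dirac t z)) c
      = ((starRingEnd ℂ) z * fourierAdjoint fc c t).re := by
  simp only [realInner, fourierMap_dirac, fourierAdjoint, Finset.mul_sum, map_mul, fourier_neg,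
    Complex.conj_conj]
  congr 1
  exact Finset.sum_congr rfl fun l _ => by ring

/-- `⟨Fₙ x, c⟩ ≤ ‖x‖_TV` as soon as `‖Fₙ* c‖_∞ ≤ 1`: the sum `∑ conj (c l) (Fₙ x) l` is the integral
of `conj (Fₙ* c)` against `x`. -/
theorem realInner_fourierMap_le_tvNorm (fc : ℕ) (c : Fin (2 * fc + 1) → ℂ)
    (hc : ∀ t, ‖fourierAdjoint fc c t‖ ≤ 1) (x : ComplexMeasure UnitAddCircle) :
    realInner (fourierMap fc x) c ≤ tvNorm x := by
  have hmul (z : ℂ) (f : UnitAddCircle → ℂ) :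
      x.integral (z • f) (ContinuousLinearMap.mul ℝ ℂ)
        = z • x.integral f (ContinuousLinearMap.mul ℝ ℂ) := by
    refine setToFun_smul _ (fun z s w => ?_) z f
    exact mul_assoc z w (x s)
  have hsum : (starRingEnd ℂ) (∑ l, (starRingEnd ℂ) (fourierMap fc x l) * c l)
      = x.integral (fun t => (starRingEnd ℂ) (fourierAdjoint fc c t))
          (ContinuousLinearMap.mul ℝ ℂ) := by
    have hq : (fun t => (starRingEnd ℂ) (fourierAdjoint fc c t))
        = fun t => ∑ l, ((starRingEnd ℂ) (c l) • ⇑(fourier (T := (1 : ℝ)) (-freq fc l))) t := by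
      ext t
      simp [fourierAdjoint]
    rw [hq, VectorMeasure.integral_finsetSum _ fun l _ => ?_]
    · simp only [map_sum, map_mul, Complex.conj_conj]
      refine Finset.sum_congr rfl fun l _ => ?_
      rw [hmul, smul_eq_mul, mul_comm]
      rfl
    · exact ((starRingEnd ℂ) (c l) • fourier (-freq fc l)).integrable_variation x
  calc realInner (fourierMap fc x) c
      ≤ ‖∑ l, (starRingEnd ℂ) (fourierMap fc x l) * c l‖ := Complex.re_le_norm _
    _ = ‖x.integral (fun t => (starRingEnd ℂ) (fourierAdjoint fc c t))
          (ContinuousLinearMap.mul ℝ ℂ)‖ := by rw [← hsum, RCLike.norm_conj]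
    _ ≤ 1 * ‖ContinuousLinearMap.mul ℝ ℂ‖ * x.variation.real Set.univ :=
        VectorMeasure.norm_integral_le_of_norm_le_const
          (Filter.Eventually.of_forall fun t => by simpa using hc t)
    _ ≤ 1 * 1 * x.variation.real Set.univ := by
        gcongr
        exact ContinuousLinearMap.opNorm_mul_le ℝ ℂ
    _ = tvNorm x := by rw [one_mul, one_mul]; rfl

theorem re_conj_mul_le {η : ℝ} {w : ℂ} (hw : ‖w‖ ≤ η) (z : ℂ) :
    ((starRingEnd ℂ) z * w).re ≤ η * ‖z‖ := by
  calc ((starRingEnd ℂ) z * w).re ≤ ‖(starRingEnd ℂ) z * w‖ := Complex.re_le_norm _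
    _ = ‖w‖ * ‖z‖ := by rw [norm_mul, RCLike.norm_conj, mul_comm]
    _ ≤ η * ‖z‖ := by gcongr

theorem realInner_le {n : ℕ} {η : ℝ} {c : Fin n → ℂ} (hc : ∀ l, ‖c l‖ ≤ η) (s : Fin n → ℂ) :
    realInner s c ≤ η * ∑ l, ‖s l‖ := by
  rw [realInner, Complex.re_sum, Finset.mul_sum]
  exact Finset.sum_le_sum fun l _ => re_conj_mul_le (hc l) (s l)

/-! ### Strong duality -/

/-- A sublinear functional is attained at every vector by a linear functional below it. -/
theorem exists_linearMap_eq_of_sublinear {E : Type*} [AddCommGroup E] [Module ℝ E] (N : E → ℝ)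
    (N_hom : ∀ r : ℝ, 0 < r → ∀ u, N (r • u) = r * N u)
    (N_add : ∀ u v, N (u + v) ≤ N u + N v) (y : E) :
    ∃ g : E →ₗ[ℝ] ℝ, g y = N y ∧ ∀ u, g u ≤ N u := by
  have N_zero : N 0 = 0 := by
    have := N_hom 2 two_pos 0
    rw [smul_zero] at this
    linarith
  by_cases hy : y = 0
  · obtain ⟨g, -, hg⟩ := exists_extension_of_le_sublinear (⊥ : E →ₗ.[ℝ] ℝ) N N_hom N_add
      (by
        rintro ⟨u, hu⟩
        obtain rfl : u = 0 := hu
        exact N_zero.ge)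
    exact ⟨g, by rw [hy, map_zero, N_zero], hg⟩
  · obtain ⟨g, hgy, hg⟩ := exists_extension_of_le_sublinear (LinearPMap.mkSpanSingleton y (N y) hy)
      N N_hom N_add (by
        rintro ⟨u, hu⟩
        obtain ⟨r, rfl⟩ := Submodule.mem_span_singleton.1 hu
        rw [LinearPMap.mkSpanSingleton'_apply, RingHom.id_apply, smul_eq_mul]
        rcases lt_trichotomy r 0 with hr | rfl | hr
        · have h1 := N_hom (-r) (neg_pos.2 hr) y
          have h2 := N_add (r • y) (-r • y)
          rw [← add_smul, add_neg_cancel, zero_smul, N_zero] at h2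
          linarith
        · simp [N_zero]
        · exact (N_hom r hr y).ge)
    refine ⟨g, ?_, hg⟩
    exact (hgy ⟨y, Submodule.mem_span_singleton_self y⟩).trans
      (LinearPMap.mkSpanSingleton_apply ℝ ℝ hy (N y))

/-- Every real-linear functional on `ℂⁿ` has the form `⟨·, c⟩`. -/
theorem exists_eq_realInner {n : ℕ} (g : (Fin n → ℂ) →ₗ[ℝ] ℝ) :
    ∃ c : Fin n → ℂ, ∀ u, g u = realInner u c := by
  refine ⟨fun l => ⟨g (Pi.single l 1), g (Pi.single l Complex.I)⟩, fun u => ?_⟩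
  have hu : u = ∑ l, ((u l).re • (Pi.single l 1 : Fin n → ℂ)
      + (u l).im • (Pi.single l Complex.I : Fin n → ℂ)) := by
    conv_lhs => rw [← Finset.univ_sum_single u]
    refine Finset.sum_congr rfl fun l _ => ?_
    rw [← Pi.single_smul, ← Pi.single_smul, ← Pi.single_add]
    congr 1
    simp [Complex.real_smul, Complex.re_add_im]
  conv_lhs => rw [hu]
  simp [realInner]

/-- The value `inf (‖x‖_TV + η ‖u - Fₙ x‖₁)` of the primal program with right-hand side `u`, where
the variable `s = u - Fₙ x` has been eliminated. -/
noncomputable def primalValue (fc : ℕ) (η : ℝ) (u : Fin (2 * fc + 1) → ℂ) : ℝ :=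
  ⨅ x : ComplexMeasure UnitAddCircle, primalCost fc η (x, u - fourierMap fc x)

theorem primalCost_nonneg (fc : ℕ) {η : ℝ} (hη : 0 ≤ η)
    (p : ComplexMeasure UnitAddCircle × (Fin (2 * fc + 1) → ℂ)) : 0 ≤ primalCost fc η p :=
  add_nonneg (tvNorm_nonneg _) (by positivity)

theorem primalCost_add_le (fc : ℕ) {η : ℝ} (hη : 0 ≤ η)
    (p q : ComplexMeasure UnitAddCircle × (Fin (2 * fc + 1) → ℂ)) :
    primalCost fc η (p + q) ≤ primalCost fc η p + primalCost fc η q := by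
  have h1 := tvNorm_add_le p.1 q.1
  have h2 : ∑ l, ‖(p.2 + q.2) l‖ ≤ ∑ l, ‖p.2 l‖ + ∑ l, ‖q.2 l‖ := by
    rw [← Finset.sum_add_distrib]
    exact Finset.sum_le_sum fun l _ => norm_add_le _ _
  have h3 := mul_le_mul_of_nonneg_left h2 hη
  simp only [primalCost, Prod.fst_add, Prod.snd_add]
  linarith

theorem primalCost_smul (fc : ℕ) (η : ℝ) {r : ℝ} (hr : 0 ≤ r)
    (p : ComplexMeasure UnitAddCircle × (Fin (2 * fc + 1) → ℂ)) :
    primalCost fc η (r • p) = r * primalCost fc η p := by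
  simp only [primalCost, Prod.smul_fst, Prod.smul_snd, tvNorm_smul, Pi.smul_apply, norm_smul,
    Real.norm_of_nonneg hr, ← Finset.mul_sum]
  ring

theorem primalValue_le (fc : ℕ) {η : ℝ} (hη : 0 ≤ η) (x : ComplexMeasure UnitAddCircle)
    (s : Fin (2 * fc + 1) → ℂ) :
    primalValue fc η (fourierMap fc x + s) ≤ primalCost fc η (x, s) := by
  have h := ciInf_le (f := fun x' : ComplexMeasure UnitAddCircle =>
    primalCost fc η (x', fourierMap fc x + s - fourierMap fc x'))
    ⟨0, by rintro _ ⟨x', rfl⟩; exact primalCost_nonneg fc hη _⟩ x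
  rw [add_sub_cancel_left] at h
  exact h

theorem primalValue_add_le (fc : ℕ) {η : ℝ} (hη : 0 ≤ η) (u v : Fin (2 * fc + 1) → ℂ) :
    primalValue fc η (u + v) ≤ primalValue fc η u + primalValue fc η v := by
  refine le_ciInf_add_ciInf fun x x' => ?_
  have h := primalValue_le fc hη (x + x') ((u - fourierMap fc x) + (v - fourierMap fc x'))
  rw [fourierMap_add] at h
  refine le_trans (le_of_eq (congrArg _ (by abel))) (h.trans ?_)
  exact primalCost_add_le fc hη (x, u - fourierMap fc x) (x', v - fourierMap fc x')

theorem primalValue_smul (fc : ℕ) {η : ℝ} (hη : 0 ≤ η) {r : ℝ} (hr : 0 < r)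
    (u : Fin (2 * fc + 1) → ℂ) : primalValue fc η (r • u) = r * primalValue fc η u := by
  have key (r : ℝ) (hr : 0 < r) (u : Fin (2 * fc + 1) → ℂ) :
      primalValue fc η (r • u) ≤ r * primalValue fc η u := by
    rw [primalValue.eq_def fc η u, Real.mul_iInf_of_nonneg hr.le]
    refine le_ciInf fun x => ?_
    have h := primalValue_le fc hη (r • x) (r • (u - fourierMap fc x))
    rw [fourierMap_smul, ← smul_add, add_sub_cancel] at h
    exact h.trans (primalCost_smul fc η hr.le (x, u - fourierMap fc x)).le
  refine le_antisymm (key r hr u) ?_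
  have h := key r⁻¹ (inv_pos.2 hr) (r • u)
  rw [inv_smul_smul₀ hr.ne'] at h
  calc r * primalValue fc η u ≤ r * (r⁻¹ * primalValue fc η (r • u)) := by gcongr
    _ = primalValue fc η (r • u) := mul_inv_cancel_left₀ hr.ne' _

/-- A functional `⟨·, c⟩` below the primal value is dual feasible, as is seen by testing it on
`Fₙ (z δ_t)` and on the vectors with one nonzero coordinate. -/
theorem mem_dualFeasible_of_le_primalValue (fc : ℕ) {η : ℝ} (hη : 0 ≤ η)
    (c : Fin (2 * fc + 1) → ℂ) (hc : ∀ u, realInner u c ≤ primalValue fc η u) :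
    c ∈ dualFeasible fc η := by
  have key (w : ℂ) (r : ℝ) (hr : 0 ≤ r) (h : ((starRingEnd ℂ) w * w).re ≤ r * ‖w‖) : ‖w‖ ≤ r := by
    rw [← Complex.normSq_eq_conj_mul_self, Complex.ofReal_re, Complex.normSq_eq_norm_sq] at h
    by_contra! hlt
    nlinarith [norm_nonneg w]
  constructor
  · intro t
    refine key _ 1 zero_le_one ?_
    rw [← realInner_fourierMap_dirac]
    refine (hc _).trans ?_
    have h := primalValue_le fc hη (VectorMeasure.dirac t (fourierAdjoint fc c t)) 0
    simpa [primalCost, tvNorm_dirac] using h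
  · intro l
    refine key _ η hη ?_
    have h1 := primalValue_le fc hη 0 (Pi.single l (c l))
    have h2 := hc (Pi.single l (c l))
    have hF : fourierMap fc 0 = 0 := funext fun l =>
      VectorMeasure.integral_zero_vectorMeasure
    have hT : tvNorm 0 = 0 := by simp [tvNorm]
    have h3 : realInner (Pi.single l (c l)) c = ((starRingEnd ℂ) (c l) * c l).re := by
      rw [realInner, Finset.sum_eq_single l] <;> simp +contextual
    have h4 : ∑ j, ‖(Pi.single l (c l) : Fin (2 * fc + 1) → ℂ) j‖ = ‖c l‖ := by
      rw [Finset.sum_eq_single l] <;> simp +contextual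
    rw [hF, zero_add, primalCost, hT, h4, zero_add] at h1
    linarith

theorem exists_dualFeasible_realInner_eq_primalValue (fc : ℕ) {η : ℝ} (hη : 0 ≤ η)
    (y : Fin (2 * fc + 1) → ℂ) :
    ∃ c ∈ dualFeasible fc η, realInner y c = primalValue fc η y := by
  obtain ⟨g, hgy, hg⟩ := exists_linearMap_eq_of_sublinear (primalValue fc η)
    (fun r hr u => primalValue_smul fc hη hr u) (primalValue_add_le fc hη) y
  obtain ⟨c, hc⟩ := exists_eq_realInner g
  exact ⟨c, mem_dualFeasible_of_le_primalValue fc hη c fun u => hc u ▸ hg u, hc y ▸ hgy⟩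

theorem primalCost_le_realInner_of_isSolution {fc : ℕ} {η : ℝ} (hη : 0 ≤ η)
    {y : Fin (2 * fc + 1) → ℂ} {x : ComplexMeasure UnitAddCircle} {s c : Fin (2 * fc + 1) → ℂ}
    (hxs : IsPrimalSolution fc η y x s) (hc : IsDualSolution fc η y c) :
    primalCost fc η (x, s) ≤ realInner y c := by
  obtain ⟨c', hc', hyc'⟩ := exists_dualFeasible_realInner_eq_primalValue fc hη y
  calc primalCost fc η (x, s) ≤ primalValue fc η y :=
        le_ciInf fun x' => hxs.2 (show fourierMap fc x' + (y - fourierMap fc x') = y by abel)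
    _ = realInner y c' := hyc'.symm
    _ ≤ realInner y c := hc.2 hc'

/-! ### Complementary slackness -/

theorem apply_singleton_of_isSuperposition {x : ComplexMeasure UnitAddCircle}
    {T : Set UnitAddCircle} {a : T → ℂ} (hx : IsSuperposition x T a) (t : T) :
    x {(t : UnitAddCircle)} = a t := by
  have ht := measurableSet_singleton (t : UnitAddCircle)
  have h := hasSum_single (f := fun t' : T => VectorMeasure.dirac (t' : UnitAddCircle) (a t')
    {(t : UnitAddCircle)}) t fun t' ht' =>
      VectorMeasure.dirac_apply_of_notMem (by simpa [Subtype.ext_iff] using ht')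
  rw [VectorMeasure.dirac_apply_of_mem ht rfl] at h
  exact (hx _ ht).unique h

/-- The equality case of `re_conj_mul_le`. -/
theorem eq_mul_exp_of_mul_norm_le_re {η : ℝ} {z w : ℂ} {θ : ℝ} (hz : z ≠ 0)
    (hθ : z = (‖z‖ : ℂ) * Complex.exp (Complex.I * (θ : ℂ))) (hw : ‖w‖ ≤ η)
    (h : η * ‖z‖ ≤ ((starRingEnd ℂ) z * w).re) :
    w = (η : ℂ) * Complex.exp (Complex.I * (θ : ℂ)) := by
  have he : ‖Complex.exp (Complex.I * (θ : ℂ))‖ = 1 := by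
    rw [mul_comm, Complex.norm_exp_ofReal_mul_I]
  set e := Complex.exp (Complex.I * (θ : ℂ))
  have hre : η ≤ ((starRingEnd ℂ) e * w).re := by
    rw [hθ, map_mul, Complex.conj_ofReal, mul_assoc, Complex.re_ofReal_mul, ← hθ, mul_comm] at h
    exact le_of_mul_le_mul_left h (norm_pos_iff.2 hz)
  have h1 : e.re * e.re + e.im * e.im = 1 := by
    rw [← Complex.normSq_apply, Complex.normSq_eq_norm_sq, he, one_pow]
  have h2 : w.re * w.re + w.im * w.im ≤ η ^ 2 := by
    rw [← Complex.normSq_apply, Complex.normSq_eq_norm_sq]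
    gcongr
  have hη : 0 ≤ η := (norm_nonneg w).trans hw
  -- `‖w - η e‖² = ‖w‖² - 2 η Re (conj e w) + η² ≤ 0`
  rw [← sub_eq_zero, ← Complex.normSq_eq_zero]
  refine le_antisymm ?_ (Complex.normSq_nonneg _)
  simp only [Complex.mul_re, Complex.conj_re, Complex.conj_im] at hre
  simp only [Complex.normSq_apply, Complex.sub_re, Complex.sub_im, Complex.re_ofReal_mul,
    Complex.im_ofReal_mul]
  have h3 := mul_le_mul_of_nonneg_left hre hη
  have h4 : η ^ 2 * (e.re * e.re + e.im * e.im) = η ^ 2 := by rw [h1, mul_one]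
  linarith

end SinesSpikes

theorem mainTheorem6 (fc : ℕ) (η : ℝ) (hη : 0 < η) (y : Fin (2 * fc + 1) → ℂ)
    -- a primal solution `x = ∑_{t ∈ T} |a_t| exp (i φ_t) δ_t`, `s_l = |s_l| exp (i ψ_l)` on `S`
    (x : ComplexMeasure UnitAddCircle) (s : Fin (2 * fc + 1) → ℂ)
    (hxs : SinesSpikes.IsPrimalSolution fc η y x s)
    (T : Set UnitAddCircle) (a : T → ℂ) (hx : SinesSpikes.IsSuperposition x T a)
    (ha : ∀ t, a t ≠ 0)
    (φ : T → ℝ) (hφ : ∀ t, a t = (‖a t‖ : ℂ) * Complex.exp (Complex.I * (φ t : ℂ)))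
    (S : Set (Fin (2 * fc + 1))) (hS : S = {l | s l ≠ 0})
    (ψ : S → ℝ) (hψ : ∀ l : S, s l = (‖s l‖ : ℂ) * Complex.exp (Complex.I * (ψ l : ℂ)))
    -- a dual solution
    (c : Fin (2 * fc + 1) → ℂ) (hc : SinesSpikes.IsDualSolution fc η y c) :
    (∀ t : T, SinesSpikes.fourierAdjoint fc c (t : UnitAddCircle)
        = Complex.exp (Complex.I * (φ t : ℂ))) ∧
    (∀ l : S, c l = (η : ℂ) * Complex.exp (Complex.I * (ψ l : ℂ))) := by
  have hopt := SinesSpikes.primalCost_le_realInner_of_isSolution hη.le hxs hc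
  have hy : SinesSpikes.fourierMap fc x + s = y := hxs.1
  obtain ⟨hq, hcη⟩ := hc.1
  rw [← hy, SinesSpikes.realInner_add_left] at hopt
  simp only [SinesSpikes.primalCost] at hopt
  constructor
  · intro t
    have hs := SinesSpikes.realInner_le hcη s
    have hr := SinesSpikes.realInner_fourierMap_le_tvNorm fc c hq
      (x.restrict {(t : UnitAddCircle)}ᶜ)
    have hsplit : SinesSpikes.realInner (SinesSpikes.fourierMap fc x) c
        = ((starRingEnd ℂ) (a t) * SinesSpikes.fourierAdjoint fc c t).re
          + SinesSpikes.realInner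
              (SinesSpikes.fourierMap fc (x.restrict {(t : UnitAddCircle)}ᶜ)) c := by
      rw [← SinesSpikes.realInner_fourierMap_dirac, ← SinesSpikes.realInner_add_left,
        ← SinesSpikes.fourierMap_add, ← SinesSpikes.apply_singleton_of_isSuperposition hx t,
        ← VectorMeasure.restrict_singleton,
        VectorMeasure.restrict_add_restrict_compl (measurableSet_singleton _)]
    have htv := SinesSpikes.tvNorm_eq_norm_apply_singleton_add x t
    rw [SinesSpikes.apply_singleton_of_isSuperposition hx t] at htv
    have h := SinesSpikes.eq_mul_exp_of_mul_norm_le_re (η := 1) (ha t) (hφ t) (hq t) (by linarith)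
    rwa [Complex.ofReal_one, one_mul] at h
  · intro l
    have hl : s l ≠ 0 := hS.subset l.2
    have hr := SinesSpikes.realInner_fourierMap_le_tvNorm fc c hq x
    -- if the bound at the coordinate `l` were strict, so would be `⟨s, c⟩ ≤ η ‖s‖₁`
    have hge : η * ‖s l‖ ≤ ((starRingEnd ℂ) (s l) * c l).re := by
      by_contra! hlt
      have hsum : SinesSpikes.realInner s c < η * ∑ j, ‖s j‖ := by
        rw [SinesSpikes.realInner, Complex.re_sum, Finset.mul_sum]
        exact Finset.sum_lt_sum (fun j _ => SinesSpikes.re_conj_mul_le (hcη j) (s j))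
          ⟨l, Finset.mem_univ _, hlt⟩
      linarith
    exact SinesSpikes.eq_mul_exp_of_mul_norm_le_re hl (hψ l) (hcη l) hge
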